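/- **Setting.** Let $f_1,\dots,f_m:\mathbb{R}^n\to\mathbb{R}$ be convex, let $X\subseteq\mathbb{R}^n$ be closed and convex, put $f=\sum_{i=1}^m f_i$, and assume that the set $X^*$ of minimizers of $f$ over $X$ is nonempty. Let $n(0),n(1),\dots$ be independent random elements of a measurable space $S$, defined on a probability space $(\Omega,\mathcal F,P)$, and let $\psi:(\mathbb{R}^n)^m\times S\to\mathbb{R}^{m\times m}$ be measurable. Each agent $i\in\{1,\dots,m\}$ starts at a deterministic point $x_i(0)\in X$ and, with $x(k)=(x_1(k),\dots,x_m(k))$ and $A(k)=[a_{ij}(k)]=\psi(x(k),n(k))$, updates its estimate by the projected multi-agent subgradient method $$v_i(k)=\sum_{j=1}^m a_{ij}(k)\,x_j(k),\qquad x_i(k+1)=P_X\big[v_i(k)-\alpha(k)\,d_i(k)\big],\qquad d_i(k)\in\partial f_i(v_i(k)),$$ where $P_X$ is the Euclidean projection on $X$, $\alpha(k)>0$ are deterministic stepsizes, and the selected subgradients $d_i(k)$ are measurable with respect to $\sigma(n(0),\dots,n(k))$. **Assumptions.** There are constants $L,K,C,\gamma>0$ and $\delta\in(0,1]$ and a directed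 graph $(\{1,\dots,m\},\mathcal E)$ such that: 1. (Bounded subgradients) $\|d\|\le L$ for all $i$, all $x\in\mathbb{R}^n$ and all $d\in\partial f_i(x)$. 2. (Connectivity) The graph is strongly connected, and for all $(j,i)\in\mathcal E$ and $k\ge0$, almost surely $$P\big(a_{ij}(k)\ge\gamma\mid x(k)\big)\ \ge\ \min\Big\{\delta,\frac{K}{\|x_i(k)-x_j(k)\|^C}\Big\},$$ where the right-hand side is read as $\delta$ if $x_i(k)=x_j(k)$. 3. (Doubly stochastic weights) For every $k\ge 0$, $A(k)$ is almost surely doubly stochastic. 4. (Self-confidence) For every $k\ge 0$ and every $i$, $a_{ii}(k)\ge\gamma$ almost surely. 5. (Stepsizes) $\sum_{k=0}^\infty\alpha(k)=\infty$ and $\lim_{k\to\infty}k\,(\log k)^p\,\alpha(k)=0$ for every real $p<1$. **Theorem.** There is a random variable $x^*$ with values in $X^*$ such that, with probability one, $\lim_{k\to\infty}x_i(k)=x^*$ for all $i\in\{1,\dots,m\}$. -/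

import Mathlib

open MeasureTheory ProbabilityTheory Filter Topology

namespace MultiAgent

/-- The decision space `ℝⁿ` with its Euclidean norm. -/
abbrev Vec (n : ℕ) := EuclideanSpace ℝ (Fin n)

/-- The joint state `x = (x_1, …, x_m)` of `m` agents with estimates in `ℝⁿ`. -/
abbrev State (m n : ℕ) := Fin m → Vec n

/-- The subdifferential `∂g(x)` of a function `g : ℝⁿ → ℝ`. -/
def subdifferential {n : ℕ} (g : Vec n → ℝ) (x : Vec n) : Set (Vec n) :=
  {d | ∀ y, g x + inner ℝ d (y - x) ≤ g y}

/-- The subgradients of the `f_i` are uniformly bounded. -/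
def BoundedSubgradients {m n : ℕ} (f : Fin m → Vec n → ℝ) : Prop :=
  ∃ L : ℝ, 0 < L ∧ ∀ i x, ∀ d ∈ subdifferential (f i) x, ‖d‖ ≤ L

/-- The set `X^*` of minimizers of `∑ i, f_i` over `X`. -/
def optimalSet {m n : ℕ} (f : Fin m → Vec n → ℝ) (X : Set (Vec n)) : Set (Vec n) :=
  {x | x ∈ X ∧ ∀ y ∈ X, ∑ i, f i x ≤ ∑ i, f i y}

open Classical in
/-- The Euclidean projection `P_X[u]`: the point of `X` closest to `u`. It exists and is unique
when `X` is nonempty, closed and convex; the value is `u` when there is no closest point. -/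
noncomputable def proj {n : ℕ} (X : Set (Vec n)) (u : Vec n) : Vec n :=
  if h : ∃ p, p ∈ X ∧ ∀ y ∈ X, ‖u - p‖ ≤ ‖u - y‖ then h.choose else u

theorem proj_spec {n : ℕ} {X : Set (Vec n)} (hX : IsClosed X) (hne : X.Nonempty) (u : Vec n) :
    proj X u ∈ X ∧ ∀ y ∈ X, ‖u - proj X u‖ ≤ ‖u - y‖ := by
  have h : ∃ p, p ∈ X ∧ ∀ y ∈ X, ‖u - p‖ ≤ ‖u - y‖ := by
    obtain ⟨p, hp, hd⟩ := hX.exists_infDist_eq_dist hne u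
    refine ⟨p, hp, fun y hy => ?_⟩
    rw [← dist_eq_norm, ← dist_eq_norm, ← hd]
    exact Metric.infDist_le_dist_of_mem hy
  unfold proj
  rw [dif_pos h]
  exact h.choose_spec

/-- Every node of the directed graph can be reached from every other one by a directed path. -/
def StronglyConnected {V : Type*} (G : Digraph V) : Prop :=
  ∀ i j, Relation.ReflTransGen G.Adj i j

/-- The lower bound `min {δ, K / r ^ C}` on the communication probability of two agents at
distance `r`, with the convention `K / 0 = ∞`, so that the value at `r = 0` is `δ`. -/
noncomputable def linkBound (δ K C r : ℝ) : ℝ :=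
  if r = 0 then δ else min δ (K / r ^ C)

/-- `k (log k)^p α(k) → 0` for all `p < 1`. -/
def LimitingStepsizes (α : ℕ → ℝ) : Prop :=
  ∀ p : ℝ, p < 1 → Tendsto (fun k : ℕ => (k : ℝ) * Real.log k ^ p * α k) atTop (𝓝 0)

/-- The weighted average `v_i = ∑ j, a_ij x_j`. -/
noncomputable def mixed {m n : ℕ} (A : Matrix (Fin m) (Fin m) ℝ) (x : State m n) : State m n :=
  fun i => ∑ j, A i j • x j

/-- The random communication matrix `A(k) = ψ(x(k), n(k))`; here `ν k` is the noise `n(k)`. -/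
def commMatrix {m n : ℕ} {Ω S : Type*} (ψ : State m n → S → Matrix (Fin m) (Fin m) ℝ)
    (ν : ℕ → Ω → S) (x : ℕ → Ω → State m n) (k : ℕ) (ω : Ω) : Matrix (Fin m) (Fin m) ℝ :=
  ψ (x k ω) (ν k ω)

/-- `x` is generated by the projected multi-agent subgradient algorithm with local objectives
`f i`, local constraint sets `X i`, stepsizes `α`, communication matrices `ψ(x(k), ν(k))` and
selected subgradients `d`:
`x_i(k+1) = P_{X_i}[v_i(k) - α(k) d_i(k)]`, `v_i(k) = ∑ j, a_ij(k) x_j(k)`,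
`d_i(k) ∈ ∂f_i(v_i(k))`, started at the deterministic point `x0`.
The choice of the subgradients at time `k` may depend on the noise up to time `k`, not on the
future noise. -/
structure IsSubgradientRun {m n : ℕ} {Ω S : Type*} [MeasurableSpace S]
    (f : Fin m → Vec n → ℝ) (X : Fin m → Set (Vec n)) (α : ℕ → ℝ)
    (ψ : State m n → S → Matrix (Fin m) (Fin m) ℝ) (ν : ℕ → Ω → S)
    (x0 : State m n) (d x : ℕ → Ω → State m n) : Prop where
  init_mem : ∀ i, x0 i ∈ X i
  init : ∀ ω, x 0 ω = x0
  subgradient : ∀ k ω i,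
    d k ω i ∈ subdifferential (f i) (mixed (commMatrix ψ ν x k ω) (x k ω) i)
  nonanticipating : ∀ k,
    Measurable[⨆ l ∈ Set.Iic k, MeasurableSpace.comap (ν l) inferInstance] (d k)
  update : ∀ k ω i,
    x (k + 1) ω i = proj (X i) (mixed (commMatrix ψ ν x k ω) (x k ω) i - α k • d k ω i)

end MultiAgent

/-! The proof separates consensus, which is probabilistic, from optimization, which is pathwise.

Consensus: doubly stochastic averaging lowers the disagreement `Q` by exactly `2m` times a weighted
dispersion (`disagreement_mixed`), hence by at least `γ` times the squared distances along the
active links. Agents move at most `L α k` per step after averaging, so almost surely their distances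
stay below a deterministic `R k` that grows like the partial sums of `α`, and each edge is active
with conditional probability at least `p k = min δ (K / R k ^ C)`. Strong connectivity turns this
into a contraction of `E Q` by `1 - q k`, with `q k` proportional to `p k`
(`integral_disagreement_mixed_le`). With the subgradient perturbation, `u k = E Q(x k)` satisfies `u
(k+1) ≤ u k + const * α k ^ 2 / q k - q k * u k / 2`. Since `α k = O(1/k)`, `1 / q k` grows slower
than any power of `k`, so `∑ α k ^ 2 / q k` converges. Hence `∑ q k * u k` converges, almost surely
`∑ q k * Q(x k)` does, and by AM-GM so does `∑ α k * √Q(x k)`.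

Optimization: on such a path, `∑ ‖x_i - z‖ ^ 2` is a quasi-Fejér sequence for every minimizer `z`
(`sum_norm_sq_succ_le`). It converges, and the objective gap and the disagreement vanish along a
subsequence; a cluster point there is a minimizer and the limit of all agents
(`Trajectory.exists_tendsto`). -/

namespace MultiAgent

variable {m n : ℕ}

/-! ### Disagreement of the agents -/

/-- The disagreement `∑ i, ∑ j, ‖x_i - x_j‖ ^ 2` of a joint state. -/
noncomputable def disagreement (x : State m n) : ℝ := ∑ i, ∑ j, ‖x i - x j‖ ^ 2

theorem disagreement_nonneg (x : State m n) : 0 ≤ disagreement x :=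
  Finset.sum_nonneg fun _ _ => Finset.sum_nonneg fun _ _ => by positivity

theorem norm_sub_sq_le_disagreement (x : State m n) (i j : Fin m) :
    ‖x i - x j‖ ^ 2 ≤ disagreement x :=
  (Finset.single_le_sum (f := fun j => ‖x i - x j‖ ^ 2) (fun _ _ => by positivity)
    (Finset.mem_univ j)).trans
    (Finset.single_le_sum (f := fun i => ∑ j, ‖x i - x j‖ ^ 2)
      (fun _ _ => Finset.sum_nonneg fun _ _ => by positivity) (Finset.mem_univ i))

theorem norm_sub_le_sqrt_disagreement (x : State m n) (i j : Fin m) :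
    ‖x i - x j‖ ≤ √(disagreement x) :=
  Real.le_sqrt_of_sq_le (norm_sub_sq_le_disagreement x i j)

/-- Variance form: since averaging preserves `∑ i, x i`, only the sum of squares changes. -/
theorem disagreement_eq (x : State m n) :
    disagreement x = 2 * m * ∑ i, ‖x i‖ ^ 2 - 2 * ‖∑ i, x i‖ ^ 2 := by
  have h : ‖∑ i, x i‖ ^ 2 = ∑ i, ∑ j, inner ℝ (x i) (x j) := by
    rw [← real_inner_self_eq_norm_sq, sum_inner]
    simp only [inner_sum]
  rw [h, disagreement]
  simp only [norm_sub_sq_real, Finset.sum_add_distrib, Finset.sum_sub_distrib, Finset.sum_const,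
    Finset.card_univ, Fintype.card_fin, nsmul_eq_mul, ← Finset.mul_sum]
  ring

/-- Young's inequality with `η` left free, to be tuned to the contraction rate. -/
theorem disagreement_add_le (v e : State m n) {η : ℝ} (hη : 0 < η) :
    disagreement (v + e) ≤ (1 + η) * disagreement v + (1 + 1 / η) * disagreement e := by
  simp only [disagreement, Finset.mul_sum, ← Finset.sum_add_distrib]
  refine Finset.sum_le_sum fun i _ => Finset.sum_le_sum fun j _ => ?_
  have h1 : (v + e) i - (v + e) j = (v i - v j) + (e i - e j) := by
    simp only [Pi.add_apply]; abel
  rw [h1]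
  have h2 := norm_add_le (v i - v j) (e i - e j)
  set a := ‖v i - v j‖
  set b := ‖e i - e j‖
  have h3 : ‖(v i - v j) + (e i - e j)‖ ^ 2 ≤ (a + b) ^ 2 := by gcongr
  refine h3.trans ?_
  have h4 : (1 + η) * a ^ 2 + (1 + 1 / η) * b ^ 2 - (a + b) ^ 2 = (η * a - b) ^ 2 / η := by
    field_simp; ring
  have h5 : 0 ≤ (η * a - b) ^ 2 / η := by positivity
  linarith

theorem disagreement_le_of_norm_le (e : State m n) {r : ℝ} (he : ∀ i, ‖e i‖ ≤ r) :
    disagreement e ≤ 4 * m ^ 2 * r ^ 2 := by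
  have h : ∀ i j, ‖e i - e j‖ ^ 2 ≤ 4 * r ^ 2 := fun i j => by
    have h1 : ‖e i - e j‖ ≤ 2 * r := (norm_sub_le _ _).trans (by linarith [he i, he j])
    calc ‖e i - e j‖ ^ 2 ≤ (2 * r) ^ 2 := by gcongr
      _ = 4 * r ^ 2 := by ring
  calc disagreement e ≤ ∑ _i : Fin m, ∑ _j : Fin m, 4 * r ^ 2 :=
        Finset.sum_le_sum fun i _ => Finset.sum_le_sum fun j _ => h i j
    _ = 4 * m ^ 2 * r ^ 2 := by simp; ring

/-! ### Averaging with doubly stochastic weights -/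

section Mixing

variable {A : Matrix (Fin m) (Fin m) ℝ}

theorem sum_mixed (hA : A ∈ doublyStochastic ℝ (Fin m)) (x : State m n) :
    ∑ i, mixed A x i = ∑ i, x i := by
  simp only [mixed]
  rw [Finset.sum_comm]
  simp only [← Finset.sum_smul, (mem_doublyStochastic_iff_sum.1 hA).2.2, one_smul]

theorem mixed_sub (hA : A ∈ doublyStochastic ℝ (Fin m)) (x : State m n) (i : Fin m) (z : Vec n) :
    mixed A x i - z = ∑ j, A i j • (x j - z) := by
  simp only [mixed, smul_sub, Finset.sum_sub_distrib, ← Finset.sum_smul,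
    (mem_doublyStochastic_iff_sum.1 hA).2.1, one_smul]

theorem mixed_mem (hA : A ∈ doublyStochastic ℝ (Fin m)) {X : Set (Vec n)} (hX : Convex ℝ X)
    {x : State m n} (hx : ∀ i, x i ∈ X) (i : Fin m) : mixed A x i ∈ X :=
  have h := mem_doublyStochastic_iff_sum.1 hA
  hX.sum_mem (fun j _ => h.1 i j) (h.2.1 i) fun j _ => hx j

theorem norm_mixed_sub_le (hA : A ∈ doublyStochastic ℝ (Fin m)) (x : State m n) (i : Fin m)
    {z : Vec n} {r : ℝ} (hr : ∀ j, ‖x j - z‖ ≤ r) : ‖mixed A x i - z‖ ≤ r := by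
  have h := mem_doublyStochastic_iff_sum.1 hA
  rw [mixed_sub hA]
  calc ‖∑ j, A i j • (x j - z)‖ ≤ ∑ j, ‖A i j • (x j - z)‖ := norm_sum_le _ _
    _ ≤ ∑ j, A i j * r := Finset.sum_le_sum fun j _ => by
        rw [norm_smul, Real.norm_of_nonneg (h.1 i j)]
        exact mul_le_mul_of_nonneg_left (hr j) (h.1 i j)
    _ = r := by rw [← Finset.sum_mul, h.2.1, one_mul]

theorem norm_mixed_sub_mixed_le (hA : A ∈ doublyStochastic ℝ (Fin m)) (x : State m n)
    {r : ℝ} (hr : ∀ i j, ‖x i - x j‖ ≤ r) (i j : Fin m) : ‖mixed A x i - mixed A x j‖ ≤ r :=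
  norm_mixed_sub_le hA x i fun l => by
    rw [norm_sub_rev]
    exact norm_mixed_sub_le hA x j fun k => by rw [norm_sub_rev]; exact hr l k

/-- Parallel-axis identity: row `i` has sum one, so the cross term vanishes at the weighted mean. -/
theorem sum_mul_norm_sq_sub (hA : A ∈ doublyStochastic ℝ (Fin m)) (x : State m n) (i : Fin m)
    (z : Vec n) : ∑ j, A i j * ‖x j - z‖ ^ 2 =
      ‖mixed A x i - z‖ ^ 2 + ∑ j, A i j * ‖x j - mixed A x i‖ ^ 2 := by
  have h := mem_doublyStochastic_iff_sum.1 hA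
  set v := mixed A x i with hv
  have h1 : ∀ j, A i j * ‖x j - z‖ ^ 2 = A i j * ‖x j - v‖ ^ 2 +
      2 * inner ℝ (A i j • (x j - v)) (v - z) + A i j * ‖v - z‖ ^ 2 := fun j => by
    have : x j - z = (x j - v) + (v - z) := by abel
    rw [this, norm_add_sq_real, real_inner_smul_left]
    ring
  simp only [h1, Finset.sum_add_distrib, ← Finset.mul_sum, ← Finset.sum_mul, ← sum_inner,
    ← mixed_sub hA, h.2.1]
  rw [← hv, sub_self, inner_zero_left]
  ring

/-- The weighted dispersion of the estimates around their averages. -/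
noncomputable def dispersion (A : Matrix (Fin m) (Fin m) ℝ) (x : State m n) : ℝ :=
  ∑ i, ∑ j, A i j * ‖x j - mixed A x i‖ ^ 2

theorem dispersion_nonneg (hA : A ∈ doublyStochastic ℝ (Fin m)) (x : State m n) :
    0 ≤ dispersion A x :=
  Finset.sum_nonneg fun i _ => Finset.sum_nonneg fun j _ =>
    mul_nonneg ((mem_doublyStochastic_iff_sum.1 hA).1 i j) (by positivity)

theorem sum_norm_sq_sub_eq (hA : A ∈ doublyStochastic ℝ (Fin m)) (x : State m n) (z : Vec n) :
    ∑ i, ‖x i - z‖ ^ 2 = ∑ i, ‖mixed A x i - z‖ ^ 2 + dispersion A x := by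
  rw [dispersion, ← Finset.sum_add_distrib]
  simp only [← sum_mul_norm_sq_sub hA]
  rw [Finset.sum_comm]
  simp only [← Finset.sum_mul, (mem_doublyStochastic_iff_sum.1 hA).2.2, one_mul]

theorem disagreement_mixed (hA : A ∈ doublyStochastic ℝ (Fin m)) (x : State m n) :
    disagreement (mixed A x) = disagreement x - 2 * m * dispersion A x := by
  have h := sum_norm_sq_sub_eq hA x 0
  simp only [sub_zero] at h
  rw [disagreement_eq, disagreement_eq, sum_mixed hA, h]
  ring

/-- The terms `l = i` and `l = j` suffice: both weights are at least `γ`, and `(a + b) ^ 2 ≤ 2 a ^ 2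
+ 2 b ^ 2`. -/
theorem half_mul_norm_sq_le (hA : A ∈ doublyStochastic ℝ (Fin m)) {γ : ℝ} (hγ : 0 < γ)
    (x : State m n) {i j : Fin m} (hi : γ ≤ A i i) (hj : γ ≤ A i j) :
    γ / 2 * ‖x i - x j‖ ^ 2 ≤ ∑ l, A i l * ‖x l - mixed A x i‖ ^ 2 := by
  have h := mem_doublyStochastic_iff_sum.1 hA
  set v := mixed A x i
  have h0 : ∀ l ∈ Finset.univ, 0 ≤ A i l * ‖x l - v‖ ^ 2 := fun l _ =>
    mul_nonneg (h.1 i l) (by positivity)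
  rcases eq_or_ne i j with rfl | hij
  · simpa using Finset.sum_nonneg h0
  have h1 : A i i * ‖x i - v‖ ^ 2 + A i j * ‖x j - v‖ ^ 2 ≤ ∑ l, A i l * ‖x l - v‖ ^ 2 := by
    rw [← Finset.sum_pair (f := fun l => A i l * ‖x l - v‖ ^ 2) hij]
    exact Finset.sum_le_sum_of_subset_of_nonneg (Finset.subset_univ _) fun l hl _ => h0 l
      (Finset.mem_univ l)
  have h2 : ‖x i - x j‖ ≤ ‖x i - v‖ + ‖x j - v‖ := by
    rw [← norm_sub_rev v (x j)]; exact norm_sub_le_norm_sub_add_norm_sub _ _ _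
  have h3 : ‖x i - x j‖ ^ 2 ≤ (‖x i - v‖ + ‖x j - v‖) ^ 2 := by gcongr
  have h4 : γ * ‖x i - v‖ ^ 2 ≤ A i i * ‖x i - v‖ ^ 2 := by gcongr
  have h5 : γ * ‖x j - v‖ ^ 2 ≤ A i j * ‖x j - v‖ ^ 2 := by gcongr
  have h6 : γ / 2 * ‖x i - x j‖ ^ 2 ≤ γ / 2 * (2 * ‖x i - v‖ ^ 2 + 2 * ‖x j - v‖ ^ 2) := by
    gcongr
    nlinarith [sq_nonneg (‖x i - v‖ - ‖x j - v‖)]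
  linarith

open Classical in
/-- One averaging step decreases the disagreement by the disagreement along the active links. -/
theorem disagreement_mixed_le (hA : A ∈ doublyStochastic ℝ (Fin m)) {γ : ℝ} (hγ : 0 < γ)
    (hself : ∀ i, γ ≤ A i i) (G : Digraph (Fin m)) (x : State m n) :
    disagreement (mixed A x) ≤ disagreement x -
      γ * ∑ i, ∑ j, (if G.Adj j i then if γ ≤ A i j then ‖x i - x j‖ ^ 2 else 0 else 0) := by
  rw [disagreement_mixed hA]
  have h0 : ∀ i, ∀ l ∈ Finset.univ, 0 ≤ A i l * ‖x l - mixed A x i‖ ^ 2 := fun i l _ =>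
    mul_nonneg ((mem_doublyStochastic_iff_sum.1 hA).1 i l) (by positivity)
  have h : γ / 2 * ∑ i, ∑ j, (if G.Adj j i then if γ ≤ A i j then ‖x i - x j‖ ^ 2 else 0 else 0)
      ≤ m * dispersion A x := by
    rw [dispersion, Finset.mul_sum, Finset.mul_sum]
    refine Finset.sum_le_sum fun i _ => ?_
    rw [Finset.mul_sum]
    calc _ ≤ ∑ _j : Fin m, ∑ l, A i l * ‖x l - mixed A x i‖ ^ 2 :=
          Finset.sum_le_sum fun j _ => by
            split_ifs with h1 h2
            · exact half_mul_norm_sq_le hA hγ x (hself i) h2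
            · simpa using Finset.sum_nonneg (h0 i)
            · simpa using Finset.sum_nonneg (h0 i)
      _ = _ := by simp
  linarith

end Mixing

open Classical in
/-- On a strongly connected graph the disagreement is controlled by that along the edges. -/
theorem exists_disagreement_le {G : Digraph (Fin m)} (hG : StronglyConnected G) :
    ∃ B : ℝ, 0 < B ∧ ∀ x : State m n, disagreement x ≤
      B * ∑ i, ∑ j, (if G.Adj j i then ‖x i - x j‖ ^ 2 else 0) := by
  have key : ∀ i j, ∃ B : ℝ, 0 ≤ B ∧ ∀ x : State m n, ‖x i - x j‖ ^ 2 ≤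
      B * ∑ i, ∑ j, (if G.Adj j i then ‖x i - x j‖ ^ 2 else 0) := fun i j => by
    induction hG i j with
    | refl => exact ⟨0, le_rfl, fun x => by simp⟩
    | @tail b c _ hbc ih =>
      obtain ⟨B, hB, h⟩ := ih
      refine ⟨2 * B + 2, by positivity, fun x => ?_⟩
      have h1 := h x
      set S := ∑ i, ∑ j, (if G.Adj j i then ‖x i - x j‖ ^ 2 else 0)
      have h0 : ∀ i j, 0 ≤ (if G.Adj j i then ‖x i - x j‖ ^ 2 else 0) := fun i j => by
        split_ifs <;> positivity
      have h2 : ‖x b - x c‖ ^ 2 ≤ S := by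
        rw [norm_sub_rev]
        calc ‖x c - x b‖ ^ 2 = (if G.Adj b c then ‖x c - x b‖ ^ 2 else 0) := by rw [if_pos hbc]
          _ ≤ ∑ j, (if G.Adj j c then ‖x c - x j‖ ^ 2 else 0) :=
            Finset.single_le_sum (f := fun j => if G.Adj j c then ‖x c - x j‖ ^ 2 else 0)
              (fun j _ => h0 c j) (Finset.mem_univ b)
          _ ≤ S := Finset.single_le_sum
              (f := fun i => ∑ j, if G.Adj j i then ‖x i - x j‖ ^ 2 else 0)
              (fun i _ => Finset.sum_nonneg fun j _ => h0 i j) (Finset.mem_univ c)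
      have h3 := norm_sub_le_norm_sub_add_norm_sub (x i) (x b) (x c)
      have h4 : ‖x i - x c‖ ^ 2 ≤ (‖x i - x b‖ + ‖x b - x c‖) ^ 2 := by gcongr
      nlinarith [sq_nonneg (‖x i - x b‖ - ‖x b - x c‖)]
  choose B hB h using key
  -- The chosen constants are only nonnegative; `+ 1` makes the total positive.
  refine ⟨∑ i, ∑ j, B i j + 1, ?_, fun x => ?_⟩
  · have := Finset.sum_nonneg fun i (_ : i ∈ Finset.univ) =>
      Finset.sum_nonneg fun j (_ : j ∈ Finset.univ) => hB i j
    linarith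
  · set S := ∑ i, ∑ j, (if G.Adj j i then ‖x i - x j‖ ^ 2 else 0)
    have hS : 0 ≤ S := Finset.sum_nonneg fun i _ => Finset.sum_nonneg fun j _ => by
      split_ifs <;> positivity
    have : disagreement x ≤ (∑ i, ∑ j, B i j) * S := by
      simp only [disagreement, Finset.sum_mul]
      exact Finset.sum_le_sum fun i _ => Finset.sum_le_sum fun j _ => h i j x
    linarith

/-! ### Projections -/

section Projection

variable {X : Set (Vec n)}

theorem inner_sub_proj_le_zero (hX : IsClosed X) (hc : Convex ℝ X) (hne : X.Nonempty) (u : Vec n)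
    {y : Vec n} (hy : y ∈ X) : inner ℝ (u - proj X u) (y - proj X u) ≤ 0 := by
  obtain ⟨hp, hmin⟩ := proj_spec hX hne u
  refine (norm_eq_iInf_iff_real_inner_le_zero hc hp).1 ?_ y hy
  have : Nonempty X := hne.to_subtype
  refine le_antisymm (le_ciInf fun w => hmin w w.2) ?_
  exact ciInf_le (f := fun w : X => ‖u - w‖) ⟨0, by rintro _ ⟨w, rfl⟩; exact norm_nonneg _⟩ ⟨_, hp⟩

/-- Adding the two obtuse-angle inequalities gives firm nonexpansiveness; Cauchy-Schwarz finishes.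
-/
theorem norm_proj_sub_proj_le (hX : IsClosed X) (hc : Convex ℝ X) (hne : X.Nonempty)
    (u w : Vec n) : ‖proj X u - proj X w‖ ≤ ‖u - w‖ := by
  have h1 := inner_sub_proj_le_zero hX hc hne u (proj_spec hX hne w).1
  have h2 := inner_sub_proj_le_zero hX hc hne w (proj_spec hX hne u).1
  set p := proj X u
  set q := proj X w
  have h3 : ‖p - q‖ ^ 2 ≤ inner ℝ (u - w) (p - q) := by
    have e : inner ℝ (u - w) (p - q) =
        ‖p - q‖ ^ 2 - inner ℝ (u - p) (q - p) - inner ℝ (w - q) (p - q) := by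
      rw [← real_inner_self_eq_norm_sq, ← neg_sub p q, inner_neg_right, sub_neg_eq_add,
        ← inner_add_left, ← inner_sub_left]
      congr 1; abel
    linarith
  have h4 := real_inner_le_norm (u - w) (p - q)
  by_contra! h
  have h5 : 0 < ‖p - q‖ := (norm_nonneg _).trans_lt h
  nlinarith

theorem proj_eq_self (hX : IsClosed X) {z : Vec n} (hz : z ∈ X) : proj X z = z := by
  have h := (proj_spec hX ⟨z, hz⟩ z).2 z hz
  rw [sub_self, norm_zero] at h
  exact (sub_eq_zero.1 (norm_le_zero_iff.1 h)).symm

theorem norm_proj_sub_le (hX : IsClosed X) (hc : Convex ℝ X) (u : Vec n) {z : Vec n}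
    (hz : z ∈ X) : ‖proj X u - z‖ ≤ ‖u - z‖ := by
  simpa only [proj_eq_self hX hz] using norm_proj_sub_proj_le hX hc ⟨z, hz⟩ u z

theorem measurable_proj (hX : IsClosed X) (hc : Convex ℝ X) (hne : X.Nonempty) :
    Measurable (proj X) :=
  (LipschitzWith.of_dist_le_mul (K := 1) fun u w => by
    simpa [dist_eq_norm] using norm_proj_sub_proj_le hX hc hne u w).continuous.measurable

end Projection

/-! ### Subgradients -/

/-- Hahn-Banach separates `(x, g x)` from the open strict epigraph; the vertical part of the
functional is negative, and dividing by it yields a slope. -/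
theorem subdifferential_nonempty {g : Vec n → ℝ} (hg : ConvexOn ℝ Set.univ g) (x : Vec n) :
    (subdifferential g x).Nonempty := by
  have hcont : Continuous g := hg.locallyLipschitz.continuous
  have hconv : Convex ℝ {p : Vec n × ℝ | p.1 ∈ Set.univ ∧ g p.1 < p.2} := hg.convex_strict_epigraph
  have hopen : IsOpen {p : Vec n × ℝ | p.1 ∈ Set.univ ∧ g p.1 < p.2} := by
    simpa using isOpen_lt (hcont.comp continuous_fst) continuous_snd
  obtain ⟨φ, hφ⟩ := geometric_hahn_banach_open_point hconv hopen
    (x := (x, g x)) (by simp)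
  have hsplit : ∀ y t, φ (y, t) = φ (y, 0) + t * φ (0, 1) := fun y t => by
    have : ((y, t) : Vec n × ℝ) = (y, 0) + t • (0, 1) := by simp
    rw [this, map_add, map_smul, smul_eq_mul]
  have hneg : φ (0, 1) < 0 := by
    have := hφ (x, g x + 1) (by simp)
    rw [hsplit x, hsplit x (g x)] at this
    linarith
  have hle : ∀ y, φ (y, g y) ≤ φ (x, g x) := fun y => by
    -- Graph points lie outside the strict epigraph; the lift below changes `φ` by exactly `-ε`.
    refine le_of_forall_pos_lt_add fun ε hε => ?_
    have := hφ (y, g y + ε / (-φ (0, 1))) (by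
      simp only [Set.mem_univ, true_and, Set.mem_ofPred_eq, lt_add_iff_pos_right]
      exact div_pos hε (neg_pos.2 hneg))
    rw [hsplit y, add_mul, div_mul_eq_mul_div, div_neg, mul_div_cancel_right₀ _ hneg.ne] at this
    rw [hsplit y]
    linarith
  let ℓ : Vec n →L[ℝ] ℝ := (-φ (0, 1))⁻¹ • φ.comp (ContinuousLinearMap.inl ℝ (Vec n) ℝ)
  refine ⟨(InnerProductSpace.toDual ℝ (Vec n)).symm ℓ, fun y => ?_⟩
  rw [InnerProductSpace.toDual_symm_apply]
  have h1 : ℓ (y - x) = (-φ (0, 1))⁻¹ * (φ (y, 0) - φ (x, 0)) := by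
    simp only [ℓ, smul_apply, ContinuousLinearMap.comp_apply,
      ContinuousLinearMap.inl_apply, smul_eq_mul, ← map_sub, Prod.mk_sub_mk, sub_zero]
  have h2 := hle y
  rw [hsplit y, hsplit x] at h2
  have h3 : (-φ (0, 1))⁻¹ * (φ (y, 0) - φ (x, 0)) ≤ g y - g x := by
    rw [inv_mul_le_iff₀ (neg_pos.2 hneg)]
    linarith
  linarith

theorem le_add_mul_norm_of_bounded_subgradients {g : Vec n → ℝ} (hg : ConvexOn ℝ Set.univ g)
    {L : ℝ} (hL : ∀ x, ∀ d ∈ subdifferential g x, ‖d‖ ≤ L) (x y : Vec n) :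
    g x ≤ g y + L * ‖y - x‖ := by
  obtain ⟨d, hd⟩ := subdifferential_nonempty hg x
  have h1 := hd y
  have h2 := (abs_le.1 (abs_real_inner_le_norm d (y - x))).1
  have h3 : ‖d‖ * ‖y - x‖ ≤ L * ‖y - x‖ := by gcongr; exact hL x d hd
  linarith

/-! ### Stepsizes and scalar recursions -/

theorem LimitingStepsizes.exists_le_div {α : ℕ → ℝ} (h : LimitingStepsizes α)
    (hα : ∀ k, 0 < α k) : ∃ c : ℝ, 0 < c ∧ ∀ k, α k ≤ c / (k + 1) := by
  have h0 : Tendsto (fun k : ℕ => (k : ℝ) * α k) atTop (𝓝 0) := by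
    simpa using h 0 one_pos
  obtain ⟨c, hc⟩ := h0.bddAbove_range
  -- `2 * c` absorbs `k + 1 ≤ 2 * k` for `k ≥ 1`; `α 0` covers `k = 0`.
  refine ⟨max (2 * c) (α 0), lt_max_of_lt_right (hα 0), fun k => ?_⟩
  rw [le_div_iff₀ (by positivity)]
  rcases Nat.eq_zero_or_pos k with rfl | hk
  · simp
  · have h1 : (k : ℝ) * α k ≤ c := hc ⟨k, rfl⟩
    have h2 : (1 : ℝ) ≤ k := by exact_mod_cast hk
    exact le_max_of_le_left (by nlinarith [hα k])

theorem sum_range_inv_le {s : ℝ} (hs : 0 < s) (k : ℕ) :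
    ∑ l ∈ Finset.range k, ((l : ℝ) + 1)⁻¹ ≤ (1 + 1 / s) * ((k : ℝ) + 1) ^ s := by
  have h1 : ∑ l ∈ Finset.range k, ((l : ℝ) + 1)⁻¹ ≤ 1 + Real.log k := by
    simpa [harmonic] using harmonic_le_one_add_log k
  have h2 : Real.log k ≤ ((k : ℝ) + 1) ^ s / s :=
    (Real.log_le_rpow_div (Nat.cast_nonneg k) hs).trans (by gcongr; linarith)
  have h3 : (1 : ℝ) ≤ ((k : ℝ) + 1) ^ s :=
    Real.one_le_rpow (by linarith [(Nat.cast_nonneg k : (0 : ℝ) ≤ k)]) hs.le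
  calc _ ≤ 1 + Real.log k := h1
    _ ≤ ((k : ℝ) + 1) ^ s + ((k : ℝ) + 1) ^ s / s := add_le_add h3 h2
    _ = _ := by ring

theorem summable_sq_mul_rpow {α : ℕ → ℝ} {a b c C : ℝ} (hα : ∀ k, 0 ≤ α k)
    (hc : ∀ k, α k ≤ c / (k + 1)) (ha : 0 ≤ a) (hb : 0 ≤ b) (hC : 0 < C) :
    Summable fun k => α k ^ 2 * (a + b * ∑ l ∈ Finset.range k, α l) ^ C := by
  have hc0 : 0 ≤ c := by simpa using (hα 0).trans (hc 0)
  -- Partial sums of `α` are `O((k+1)^s)`, so their `C`-th power costs only `(k+1)^(1/2)`, leaving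
  -- the summable `(k+1)^(-3/2)`.
  set s := 1 / (2 * C) with hs
  have hs0 : 0 < s := by positivity
  set B := a + b * (c * (1 + 1 / s))
  have hB : 0 ≤ B := by positivity
  have hsum : Summable fun k : ℕ => c ^ 2 * B ^ C * ((k : ℝ) + 1) ^ (-(3 / 2) : ℝ) := by
    refine Summable.mul_left _ ?_
    have := (summable_nat_add_iff 1).2
      (Real.summable_nat_rpow.2 (by norm_num : (-(3 / 2) : ℝ) < -1))
    simpa using this
  have hS : ∀ k, 0 ≤ ∑ l ∈ Finset.range k, α l := fun k => Finset.sum_nonneg fun l _ => hα l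
  refine Summable.of_nonneg_of_le (fun k => ?_) (fun k => ?_) hsum
  · have := hS k
    positivity
  have hk : (0 : ℝ) < (k : ℝ) + 1 := by positivity
  have h1 : ∑ l ∈ Finset.range k, α l ≤ c * (1 + 1 / s) * ((k : ℝ) + 1) ^ s := by
    rw [mul_assoc]
    refine le_trans ?_ (mul_le_mul_of_nonneg_left (sum_range_inv_le hs0 k) hc0)
    rw [Finset.mul_sum]
    exact Finset.sum_le_sum fun l _ => by simpa [div_eq_mul_inv] using hc l
  have h2 : (1 : ℝ) ≤ ((k : ℝ) + 1) ^ s :=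
    Real.one_le_rpow (by linarith [(Nat.cast_nonneg k : (0 : ℝ) ≤ k)]) hs0.le
  have h3 : a + b * ∑ l ∈ Finset.range k, α l ≤ B * ((k : ℝ) + 1) ^ s := by
    have h4 := mul_le_mul_of_nonneg_left h1 hb
    have h5 := mul_le_mul_of_nonneg_left h2 ha
    simp only [B]
    linarith
  have h6 : (a + b * ∑ l ∈ Finset.range k, α l) ^ C ≤ B ^ C * ((k : ℝ) + 1) ^ (1 / 2 : ℝ) := by
    have := hS k
    refine (Real.rpow_le_rpow (by positivity) h3 hC.le).trans_eq ?_
    rw [Real.mul_rpow hB (by positivity), ← Real.rpow_mul hk.le]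
    congr 2
    rw [hs]; field_simp
  have h7 : α k ^ 2 ≤ c ^ 2 * ((k : ℝ) + 1) ^ (-2 : ℝ) := by
    have h8 : α k ^ 2 ≤ (c / (k + 1)) ^ 2 := by
      have := hα k
      gcongr
      exact hc k
    refine h8.trans_eq ?_
    rw [Real.rpow_neg hk.le, div_pow, div_eq_mul_inv, Real.rpow_ofNat]
  calc _ ≤ (c ^ 2 * ((k : ℝ) + 1) ^ (-2 : ℝ)) * (B ^ C * ((k : ℝ) + 1) ^ (1 / 2 : ℝ)) := by
        have := hS k
        gcongr
    _ = c ^ 2 * B ^ C * (((k : ℝ) + 1) ^ (-2 : ℝ) * ((k : ℝ) + 1) ^ (1 / 2 : ℝ)) := by ring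
    _ = _ := by rw [← Real.rpow_add hk]; norm_num

theorem summable_of_le_add_sub {a b c : ℕ → ℝ} (ha : ∀ k, 0 ≤ a k) (hb : ∀ k, 0 ≤ b k)
    (hc : ∀ k, 0 ≤ c k) (hbs : Summable b) (h : ∀ k, a (k + 1) ≤ a k + b k - c k) :
    Summable c := by
  have key : ∀ N, a N + ∑ k ∈ Finset.range N, c k ≤ a 0 + ∑ k ∈ Finset.range N, b k := fun N => by
    induction N with
    | zero => simp
    | succ N ih => rw [Finset.sum_range_succ, Finset.sum_range_succ]; linarith [h N]
  refine summable_of_sum_range_le hc (c := a 0 + ∑' k, b k) fun N => ?_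
  linarith [key N, ha N, hbs.sum_le_tsum (Finset.range N) fun k _ => hb k]

/-- The deterministic Robbins-Siegmund lemma. -/
theorem exists_tendsto_of_le_add_sub {a b c : ℕ → ℝ} (ha : ∀ k, 0 ≤ a k) (hb : ∀ k, 0 ≤ b k)
    (hc : ∀ k, 0 ≤ c k) (hbs : Summable b) (h : ∀ k, a (k + 1) ≤ a k + b k - c k) :
    ∃ l, Tendsto a atTop (𝓝 l) := by
  have hcs := summable_of_le_add_sub ha hb hc hbs h
  set s : ℕ → ℝ := fun N => a N + ∑ k ∈ Finset.range N, c k - ∑ k ∈ Finset.range N, b k with hs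
  have hanti : Antitone s := antitone_nat_of_succ_le fun N => by
    simp only [hs, Finset.sum_range_succ]; linarith [h N]
  have hbdd : BddBelow (Set.range s) := ⟨-∑' k, b k, by
    rintro _ ⟨N, rfl⟩
    have h1 := hbs.sum_le_tsum (Finset.range N) fun k _ => hb k
    have h2 := Finset.sum_nonneg fun k (_ : k ∈ Finset.range N) => hc k
    simp only [hs]; linarith [ha N]⟩
  have ht := ((tendsto_atTop_ciInf hanti hbdd).sub hcs.hasSum.tendsto_sum_nat).add
    hbs.hasSum.tendsto_sum_nat
  exact ⟨_, ht.congr fun N => by simp only [hs]; ring⟩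

theorem frequently_lt_of_summable_mul {α g : ℕ → ℝ} (hα : ∀ k, 0 ≤ α k)
    (hsum : Tendsto (fun N => ∑ k ∈ Finset.range N, α k) atTop atTop)
    (h : Summable fun k => α k * g k) {ε : ℝ} (hε : 0 < ε) : ∃ᶠ k in atTop, g k < ε := by
  intro hev
  have hev : ∀ᶠ k in atTop, ε ≤ g k := hev.mono fun k hk => not_lt.1 hk
  refine (not_summable_iff_tendsto_nat_atTop_of_nonneg hα).2 hsum ?_
  refine Summable.of_norm_bounded_eventually_nat (h.mul_left ε⁻¹) (hev.mono fun k hk => ?_)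
  rw [Real.norm_of_nonneg (hα k), le_inv_mul_iff₀ hε, mul_comm]
  exact mul_le_mul_of_nonneg_left hk (hα k)

/-! ### Convergence along a trajectory with summable weighted disagreement -/

/-- A deterministic trajectory of the projected subgradient method with doubly stochastic
weights. -/
structure Trajectory (f : Fin m → Vec n → ℝ) (X : Set (Vec n)) (α : ℕ → ℝ)
    (A : ℕ → Matrix (Fin m) (Fin m) ℝ) (d x : ℕ → State m n) : Prop where
  init_mem : ∀ i, x 0 i ∈ X
  stochastic : ∀ k, A k ∈ doublyStochastic ℝ (Fin m)
  subgradient : ∀ k i, d k i ∈ subdifferential (f i) (mixed (A k) (x k) i)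
  update : ∀ k i, x (k + 1) i = proj X (mixed (A k) (x k) i - α k • d k i)

namespace Trajectory

variable {f : Fin m → Vec n → ℝ} {X : Set (Vec n)} {α : ℕ → ℝ}
  {A : ℕ → Matrix (Fin m) (Fin m) ℝ} {d x : ℕ → State m n}

theorem mem (h : Trajectory f X α A d x) (hX : IsClosed X) (hne : X.Nonempty) :
    ∀ k i, x k i ∈ X
  | 0, i => h.init_mem i
  | k + 1, i => by rw [h.update]; exact (proj_spec hX hne _).1

/-- The average already lies in the convex set `X`, so projecting cannot increase the distance to
it. -/
theorem norm_sub_mixed_le (h : Trajectory f X α A d x) (hX : IsClosed X) (hc : Convex ℝ X)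
    (hne : X.Nonempty) (hα : ∀ k, 0 ≤ α k) {L : ℝ}
    (hL : ∀ i x, ∀ d ∈ subdifferential (f i) x, ‖d‖ ≤ L) (k : ℕ) (i : Fin m) :
    ‖x (k + 1) i - mixed (A k) (x k) i‖ ≤ L * α k := by
  rw [h.update]
  refine (norm_proj_sub_le hX hc _ (mixed_mem (h.stochastic k) hc (h.mem hX hne k) i)).trans ?_
  rw [sub_sub_cancel_left, norm_neg, norm_smul, Real.norm_of_nonneg (hα k), mul_comm]
  exact mul_le_mul_of_nonneg_right (hL i _ _ (h.subgradient k i)) (hα k)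

theorem norm_sub_le (h : Trajectory f X α A d x) (hX : IsClosed X) (hc : Convex ℝ X)
    (hne : X.Nonempty) (hα : ∀ k, 0 ≤ α k) {L : ℝ}
    (hL : ∀ i x, ∀ d ∈ subdifferential (f i) x, ‖d‖ ≤ L) {r : ℝ}
    (hr : ∀ i j, ‖x 0 i - x 0 j‖ ≤ r) (k : ℕ) :
    ∀ i j, ‖x k i - x k j‖ ≤ r + 2 * L * ∑ l ∈ Finset.range k, α l := by
  induction k with
  | zero => simpa using hr
  | succ k ih =>
    intro i j
    have h1 := norm_mixed_sub_mixed_le (h.stochastic k) (x k) ih i j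
    have h2 := h.norm_sub_mixed_le hX hc hne hα hL k i
    have h3 := h.norm_sub_mixed_le hX hc hne hα hL k j
    rw [Finset.sum_range_succ]
    set v := mixed (A k) (x k)
    have h4 : x (k + 1) i - x (k + 1) j =
        (x (k + 1) i - v i) + (v i - v j) - (x (k + 1) j - v j) := by abel
    rw [h4]
    have h5 := _root_.norm_sub_le ((x (k + 1) i - v i) + (v i - v j)) (x (k + 1) j - v j)
    have h6 := norm_add_le (x (k + 1) i - v i) (v i - v j)
    linarith

theorem disagreement_succ_le (h : Trajectory f X α A d x) (hX : IsClosed X) (hc : Convex ℝ X)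
    (hne : X.Nonempty) (hα : ∀ k, 0 ≤ α k) {L : ℝ}
    (hL : ∀ i x, ∀ d ∈ subdifferential (f i) x, ‖d‖ ≤ L) {η : ℝ} (hη : 0 < η) (k : ℕ) :
    disagreement (x (k + 1)) ≤ (1 + η) * disagreement (mixed (A k) (x k)) +
      (1 + 1 / η) * (4 * m ^ 2 * (L * α k) ^ 2) := by
  have h1 := disagreement_add_le (mixed (A k) (x k)) (x (k + 1) - mixed (A k) (x k)) hη
  rw [add_sub_cancel] at h1
  refine h1.trans ?_
  gcongr
  exact disagreement_le_of_norm_le _ (h.norm_sub_mixed_le hX hc hne hα hL k)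

/-- Quasi-Fejér estimate. Moving every `f i` from `v i` to the common point `x k i₀` lets the local
gaps add up to the global gap, at Lipschitz cost `L * √Q` each. -/
theorem sum_norm_sq_succ_le (h : Trajectory f X α A d x) (hX : IsClosed X) (hc : Convex ℝ X)
    (hf : ∀ i, ConvexOn ℝ Set.univ (f i)) (hα : ∀ k, 0 ≤ α k) {L : ℝ} (hL0 : 0 ≤ L)
    (hL : ∀ i x, ∀ d ∈ subdifferential (f i) x, ‖d‖ ≤ L) {z : Vec n} (hz : z ∈ X) (i₀ : Fin m)
    (k : ℕ) : ∑ i, ‖x (k + 1) i - z‖ ^ 2 ≤ ∑ i, ‖x k i - z‖ ^ 2 +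
      (2 * m * L * (α k * √(disagreement (x k))) + m * L ^ 2 * α k ^ 2) -
      2 * (α k * (∑ i, f i (x k i₀) - ∑ i, f i z)) := by
  set v := mixed (A k) (x k) with hv
  set q := √(disagreement (x k))
  have hi : ∀ i, ‖x (k + 1) i - z‖ ^ 2 ≤ ‖v i - z‖ ^ 2 +
      (2 * L * (α k * q) + L ^ 2 * α k ^ 2) - 2 * (α k * (f i (x k i₀) - f i z)) := fun i => by
    have hd := h.subgradient k i
    rw [← hv] at hd
    have h1 : ‖x (k + 1) i - z‖ ≤ ‖(v i - z) - α k • d k i‖ := by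
      rw [h.update, sub_right_comm]
      exact norm_proj_sub_le hX hc _ hz
    have h2 : ‖x (k + 1) i - z‖ ^ 2 ≤ ‖(v i - z) - α k • d k i‖ ^ 2 := by gcongr
    rw [norm_sub_sq_real (v i - z), norm_smul, Real.norm_of_nonneg (hα k), real_inner_smul_right,
      real_inner_comm, mul_pow] at h2
    have h3 := hd z
    rw [← neg_sub, inner_neg_right] at h3
    have h4 := le_add_mul_norm_of_bounded_subgradients (hf i) (hL i) (x k i₀) (v i)
    have h5 : ‖v i - x k i₀‖ ≤ q := norm_mixed_sub_le (h.stochastic k) _ i fun j =>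
      norm_sub_le_sqrt_disagreement _ j i₀
    have h6 : f i (x k i₀) - f i z - L * q ≤ inner ℝ (d k i) (v i - z) := by
      linarith [mul_le_mul_of_nonneg_left h5 hL0]
    have h7 := mul_le_mul_of_nonneg_left h6 (hα k)
    have h8 : ‖d k i‖ ^ 2 ≤ L ^ 2 := by gcongr; exact hL i _ _ hd
    have h9 := mul_le_mul_of_nonneg_left h8 (sq_nonneg (α k))
    linarith
  have hsum := Finset.sum_le_sum fun i (_ : i ∈ Finset.univ) => hi i
  have hmix := sum_norm_sq_sub_eq (h.stochastic k) (x k) z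
  have hdisp := dispersion_nonneg (h.stochastic k) (x k)
  simp only [Finset.sum_add_distrib, Finset.sum_sub_distrib, ← Finset.mul_sum, Finset.sum_const,
    Finset.card_univ, Fintype.card_fin, nsmul_eq_mul] at hsum
  rw [← hv] at hmix
  linarith

/-- If the stepsizes are square summable but not summable, and the disagreement is summable when
weighted with the stepsizes, the agents converge to a common minimizer. -/
theorem exists_tendsto (h : Trajectory f X α A d x) (hX : IsClosed X) (hc : Convex ℝ X)
    (hf : ∀ i, ConvexOn ℝ Set.univ (f i)) (hopt : (optimalSet f X).Nonempty)
    (hL : BoundedSubgradients f) (hα : ∀ k, 0 ≤ α k)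
    (hαsum : Tendsto (fun N => ∑ k ∈ Finset.range N, α k) atTop atTop)
    (hαsq : Summable fun k => α k ^ 2)
    (hdis : Summable fun k => α k * √(disagreement (x k))) :
    ∃ z ∈ optimalSet f X, ∀ i, Tendsto (fun k => x k i) atTop (𝓝 z) := by
  obtain ⟨z₀, hz₀⟩ := hopt
  rcases isEmpty_or_nonempty (Fin m) with he | ⟨⟨i₀⟩⟩
  · exact ⟨z₀, hz₀, fun i => he.elim i⟩
  obtain ⟨L, hL0, hL⟩ := hL
  have hmem := h.mem hX ⟨z₀, hz₀.1⟩
  set b : ℕ → ℝ := fun k =>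
    2 * m * L * (α k * √(disagreement (x k))) + m * L ^ 2 * α k ^ 2
  have hb : ∀ k, 0 ≤ b k := fun k => by
    have := hα k
    positivity
  have hbs : Summable b := (hdis.mul_left _).add (hαsq.mul_left _)
  have hgap : ∀ z ∈ optimalSet f X, ∀ k, 0 ≤ ∑ i, f i (x k i₀) - ∑ i, f i z := fun z hz k =>
    sub_nonneg.2 (hz.2 _ (hmem k i₀))
  have hgap' : ∀ z ∈ optimalSet f X, ∀ k,
      0 ≤ 2 * (α k * (∑ i, f i (x k i₀) - ∑ i, f i z)) := fun z hz k =>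
    mul_nonneg zero_le_two (mul_nonneg (hα k) (hgap z hz k))
  have ha : ∀ z k, 0 ≤ ∑ i, ‖x k i - z‖ ^ 2 := fun z k =>
    Finset.sum_nonneg fun i _ => by positivity
  have hlim : ∀ z ∈ optimalSet f X, ∃ l, Tendsto (fun k => ∑ i, ‖x k i - z‖ ^ 2) atTop (𝓝 l) :=
    fun z hz => exists_tendsto_of_le_add_sub (ha z) hb (hgap' z hz) hbs fun k =>
      h.sum_norm_sq_succ_le hX hc hf hα hL0.le hL hz.1 i₀ k
  set F : Vec n → ℝ := fun y => ∑ i, f i y with hF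
  have hFc : Continuous F := continuous_finsetSum _ fun i _ => (hf i).locallyLipschitz.continuous
  -- Adding the two nonnegative quantities lets one subsequence make both vanish.
  set g : ℕ → ℝ := fun k => (F (x k i₀) - F z₀) + √(disagreement (x k)) with hg
  have hg0 : ∀ k, 0 ≤ g k := fun k => add_nonneg (hgap z₀ hz₀ k) (Real.sqrt_nonneg _)
  have hgs : Summable fun k => α k * g k := by
    have h1 := summable_of_le_add_sub (ha z₀) hb (hgap' z₀ hz₀) hbs fun k =>
      h.sum_norm_sq_succ_le hX hc hf hα hL0.le hL hz₀.1 i₀ k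
    refine ((h1.mul_left (1 / 2)).add hdis).congr fun k => ?_
    simp only [hg, hF]; ring
  -- along a subsequence the objective gap and the disagreement vanish
  have hcl : MapClusterPt 0 atTop g := by
    rw [mapClusterPt_iff_frequently]
    intro s hs
    obtain ⟨ε, hε, hεs⟩ := Metric.mem_nhds_iff.1 hs
    refine (frequently_lt_of_summable_mul hα hαsum hgs hε).mono fun k hk => hεs ?_
    rwa [mem_ball_zero_iff, Real.norm_of_nonneg (hg0 k)]
  obtain ⟨φ, hφ, hφg⟩ := hcl.tendsto_subseq
  obtain ⟨l₀, hl₀⟩ := hlim z₀ hz₀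
  obtain ⟨B, hB⟩ := hl₀.bddAbove_range
  have hbdd : ∀ k, x k i₀ ∈ Metric.closedBall z₀ √B := fun k => by
    rw [mem_closedBall_iff_norm]
    refine Real.le_sqrt_of_sq_le (le_trans ?_ (hB ⟨k, rfl⟩))
    exact Finset.single_le_sum (f := fun i => ‖x k i - z₀‖ ^ 2) (fun _ _ => by positivity)
      (Finset.mem_univ i₀)
  obtain ⟨z, -, θ, hθ, hz⟩ := tendsto_subseq_of_bounded Metric.isBounded_closedBall
    fun k => hbdd (φ k)
  have hgθ : Tendsto (fun k => g (φ (θ k))) atTop (𝓝 0) := hφg.comp hθ.tendsto_atTop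
  have hsub : Tendsto (fun k => φ (θ k)) atTop atTop := hφ.tendsto_atTop.comp hθ.tendsto_atTop
  have hFz : F z ≤ F z₀ := by
    have h1 : Tendsto (fun k => F (x (φ (θ k)) i₀)) atTop (𝓝 (F z)) := (hFc.tendsto z).comp hz
    refine sub_nonpos.1 (le_of_tendsto_of_tendsto (h1.sub_const _) hgθ (Eventually.of_forall
      fun k => ?_))
    exact le_add_of_nonneg_right (Real.sqrt_nonneg _)
  have hzX : z ∈ X := hX.mem_of_tendsto hz (Eventually.of_forall fun k => hmem _ _)
  have hzopt : z ∈ optimalSet f X := ⟨hzX, fun y hy => hFz.trans (hz₀.2 y hy)⟩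
  have hdist : Tendsto (fun k => √(disagreement (x (φ (θ k))))) atTop (𝓝 0) :=
    squeeze_zero (fun _ => Real.sqrt_nonneg _)
      (fun k => le_add_of_nonneg_left (hgap z₀ hz₀ _)) hgθ
  have hall : ∀ i, Tendsto (fun k => x (φ (θ k)) i) atTop (𝓝 z) := fun i => by
    have h1 : Tendsto (fun k => x (φ (θ k)) i - x (φ (θ k)) i₀) atTop (𝓝 0) :=
      squeeze_zero_norm (fun k => norm_sub_le_sqrt_disagreement _ i i₀) hdist
    simpa using h1.add hz
  -- The Fejér argument is repeated around the cluster point itself: the whole sequence of squared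
  -- distances converges, and its subsequential limit is `0`.
  obtain ⟨l, hl⟩ := hlim z hzopt
  have hl0 : l = 0 := by
    refine tendsto_nhds_unique (hl.comp hsub) ?_
    have : Tendsto (fun k => ∑ i, ‖x (φ (θ k)) i - z‖ ^ 2) atTop (𝓝 (∑ _i : Fin m, 0)) :=
      tendsto_finsetSum _ fun i _ => by
        have := ((hall i).sub_const z).norm.pow 2
        simpa using this
    simpa [Function.comp_def] using this
  rw [hl0] at hl
  refine ⟨z, hzopt, fun i => tendsto_iff_norm_sub_tendsto_zero.2 ?_⟩
  have h1 : Tendsto (fun k => ‖x k i - z‖ ^ 2) atTop (𝓝 0) :=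
    squeeze_zero (fun _ => by positivity) (fun k =>
      Finset.single_le_sum (f := fun i => ‖x k i - z‖ ^ 2) (fun _ _ => by positivity)
        (Finset.mem_univ i)) hl
  have h2 := h1.sqrt
  simpa using h2

end Trajectory

/-! ### Two facts about expectations -/

/-- The `F`-measurable factor `g` is pulled out of the conditional expectation of `g * 1_B`. -/
theorem mul_integral_le_of_le_condExp {Ω : Type*} {F mΩ : MeasurableSpace Ω} {P : Measure Ω}
    [IsProbabilityMeasure P] (hF : F ≤ mΩ) {g : Ω → ℝ} (hg : StronglyMeasurable[F] g)
    (hgi : Integrable g P) (hg0 : 0 ≤ g) {B : Set Ω} (hB : MeasurableSet B) {p : ℝ}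
    (hp : ∀ᵐ ω ∂P, p ≤ (P⟦B | F⟧) ω) : p * ∫ ω, g ω ∂P ≤ ∫ ω, B.indicator g ω ∂P := by
  have h1 : g * B.indicator (fun _ => (1 : ℝ)) = B.indicator g := by
    ext ω
    by_cases h : ω ∈ B <;> simp [h]
  have hBi : Integrable (g * B.indicator (fun _ => (1 : ℝ))) P := h1 ▸ hgi.indicator hB
  have h2 := condExp_mul_of_stronglyMeasurable_left hg hBi
    ((integrable_const (1 : ℝ)).indicator hB)
  rw [← h1, ← integral_condExp hF (f := g * B.indicator fun _ => (1 : ℝ)), integral_congr_ae h2, ← integral_const_mul]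
  refine integral_mono_ae (hgi.const_mul p) ((integrable_congr h2).1 integrable_condExp) ?_
  filter_upwards [hp] with ω hω
  rw [mul_comm]
  exact mul_le_mul_of_nonneg_left hω (hg0 ω)

theorem ae_summable_of_summable_integral {Ω : Type*} [MeasurableSpace Ω] {P : Measure Ω}
    {F : ℕ → Ω → ℝ} (hF0 : ∀ k ω, 0 ≤ F k ω) (hF : ∀ k, Integrable (F k) P)
    (hs : Summable fun k => ∫ ω, F k ω ∂P) : ∀ᵐ ω ∂P, Summable fun k => F k ω := by
  have hm : ∀ k, AEMeasurable (fun ω => ENNReal.ofReal (F k ω)) P := fun k =>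
    (hF k).aestronglyMeasurable.aemeasurable.ennreal_ofReal
  have h1 : ∫⁻ ω, ∑' k, ENNReal.ofReal (F k ω) ∂P ≠ ⊤ := by
    rw [lintegral_tsum hm]
    simp only [← ofReal_integral_eq_lintegral_ofReal (hF _) (Eventually.of_forall (hF0 _))]
    exact hs.tsum_ofReal_ne_top
  filter_upwards [ae_lt_top' (AEMeasurable.tsum hm) h1] with ω hω
  refine (ENNReal.summable_toReal hω.ne).congr fun k => ?_
  rw [ENNReal.toReal_ofReal (hF0 k ω)]

/-! ### Communication probabilities -/

theorem min_div_rpow_le_linkBound {δ K C r R : ℝ} (hK : 0 ≤ K) (hC : 0 ≤ C) (hr : 0 ≤ r)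
    (hrR : r ≤ R) : min δ (K / R ^ C) ≤ linkBound δ K C r := by
  unfold linkBound
  split_ifs with h
  · exact min_le_left _ _
  · have h1 : 0 < r := lt_of_le_of_ne hr (Ne.symm h)
    exact min_le_min_left _ (by gcongr)

theorem inv_min_div_rpow_le {δ K C R : ℝ} (hδ : 0 < δ) (hK : 0 < K) (hC : 0 ≤ C) (hR : 1 ≤ R) :
    (min δ (K / R ^ C))⁻¹ ≤ (δ⁻¹ + K⁻¹) * R ^ C := by
  have h1 : 1 ≤ R ^ C := Real.one_le_rpow hR hC
  rw [add_mul]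
  rcases min_choice δ (K / R ^ C) with h | h <;> rw [h]
  · have := le_mul_of_one_le_right (inv_nonneg.2 hδ.le) h1
    have : 0 ≤ K⁻¹ * R ^ C := by positivity
    linarith
  · rw [inv_div, div_eq_inv_mul]
    have : 0 ≤ δ⁻¹ * R ^ C := by positivity
    linarith

/-! ### Random trajectories -/

namespace IsSubgradientRun

variable {Ω S : Type*} [MeasurableSpace Ω] [MeasurableSpace S] {P : Measure Ω}
  {f : Fin m → Vec n → ℝ} {X : Set (Vec n)} {α : ℕ → ℝ}
  {ψ : State m n → S → Matrix (Fin m) (Fin m) ℝ} {ν : ℕ → Ω → S} {x0 : State m n}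
  {d x : ℕ → Ω → State m n}

theorem measurable_commMatrix (hν : ∀ k, Measurable (ν k))
    (hψ : ∀ i j, Measurable (fun z : State m n × S => ψ z.1 z.2 i j)) {k : ℕ}
    (hx : Measurable (x k)) (i j : Fin m) :
    Measurable fun ω => commMatrix ψ ν x k ω i j :=
  (hψ i j).comp (hx.prodMk (hν k))

theorem measurable_mixed (hν : ∀ k, Measurable (ν k))
    (hψ : ∀ i j, Measurable (fun z : State m n × S => ψ z.1 z.2 i j)) {k : ℕ}
    (hx : Measurable (x k)) :
    Measurable fun ω => mixed (commMatrix ψ ν x k ω) (x k ω) :=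
  measurable_pi_iff.2 fun i => Finset.measurable_fun_sum _ fun j _ =>
    (measurable_commMatrix hν hψ hx i j).smul ((measurable_pi_apply j).comp hx)

theorem measurable (h : IsSubgradientRun f (fun _ => X) α ψ ν x0 d x) (hX : IsClosed X)
    (hc : Convex ℝ X) (hne : X.Nonempty) (hν : ∀ k, Measurable (ν k))
    (hψ : ∀ i j, Measurable (fun z : State m n × S => ψ z.1 z.2 i j)) :
    ∀ k, Measurable (x k)
  | 0 => by
    rw [show x 0 = fun _ => x0 from funext h.init]
    exact measurable_const
  | k + 1 => by
    have hx := measurable h hX hc hne hν hψ k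
    have hd : Measurable (d k) :=
      (h.nonanticipating k).mono (iSup₂_le fun l _ => (hν l).comap_le) le_rfl
    refine measurable_pi_iff.2 fun i => ?_
    simp only [h.update]
    exact (measurable_proj hX hc hne).comp
      (((measurable_pi_apply i).comp (measurable_mixed hν hψ hx)).sub
        (((measurable_pi_apply i).comp hd).const_smul (α k)))

theorem ae_trajectory (h : IsSubgradientRun f (fun _ => X) α ψ ν x0 d x)
    (hstoch : ∀ k, ∀ᵐ ω ∂P, commMatrix ψ ν x k ω ∈ doublyStochastic ℝ (Fin m)) :
    ∀ᵐ ω ∂P, Trajectory f X α (fun k => commMatrix ψ ν x k ω) (fun k => d k ω)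
      (fun k => x k ω) := by
  filter_upwards [ae_all_iff.2 hstoch] with ω hω
  exact ⟨fun i => by rw [h.init]; exact h.init_mem i, hω, fun k i => h.subgradient k ω i,
    fun k i => h.update k ω i⟩

end IsSubgradientRun

/-! ### Contraction of the expected disagreement -/

theorem measurable_disagreement : Measurable (disagreement : State m n → ℝ) :=
  Finset.measurable_fun_sum _ fun i _ => Finset.measurable_fun_sum _ fun j _ =>
    (((measurable_pi_apply i).sub (measurable_pi_apply j)).norm.pow_const 2)

theorem disagreement_le_of_norm_sub_le {x : State m n} {r : ℝ} (h : ∀ i j, ‖x i - x j‖ ≤ r) :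
    disagreement x ≤ m ^ 2 * r ^ 2 :=
  calc disagreement x ≤ ∑ _i : Fin m, ∑ _j : Fin m, r ^ 2 :=
        Finset.sum_le_sum fun i _ => Finset.sum_le_sum fun j _ => by gcongr; exact h i j
    _ = _ := by simp; ring

theorem integrable_disagreement {Ω : Type*} [MeasurableSpace Ω] {P : Measure Ω}
    [IsFiniteMeasure P] {y : Ω → State m n} (hy : Measurable y) {r : ℝ}
    (h : ∀ᵐ ω ∂P, ∀ i j, ‖y ω i - y ω j‖ ≤ r) : Integrable (fun ω => disagreement (y ω)) P := by
  refine Integrable.of_bound (measurable_disagreement.comp hy).aestronglyMeasurable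
    (m ^ 2 * r ^ 2) ?_
  filter_upwards [h] with ω hω
  rw [Real.norm_of_nonneg (disagreement_nonneg _)]
  exact disagreement_le_of_norm_sub_le hω

/-- If the links of a strongly connected graph are active with conditional probability at least
`p`, averaging contracts the expected disagreement by a factor `1 - γ p / B`, where `B` is a
constant of the graph. -/
theorem integral_disagreement_mixed_le {Ω : Type*} [MeasurableSpace Ω] {P : Measure Ω}
    [IsProbabilityMeasure P] {G : Digraph (Fin m)} {B γ p r : ℝ} (hB0 : 0 < B)
    (hB : ∀ x : State m n, disagreement x ≤
      B * ∑ i, ∑ j, (open Classical in if G.Adj j i then ‖x i - x j‖ ^ 2 else 0))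
    (hγ : 0 < γ) (hp0 : 0 ≤ p) {y : Ω → State m n} (hy : Measurable y)
    {A : Ω → Matrix (Fin m) (Fin m) ℝ} (hA : ∀ i j, Measurable fun ω => A ω i j)
    (hr : ∀ᵐ ω ∂P, ∀ i j, ‖y ω i - y ω j‖ ≤ r)
    (hstoch : ∀ᵐ ω ∂P, A ω ∈ doublyStochastic ℝ (Fin m))
    (hself : ∀ i, ∀ᵐ ω ∂P, γ ≤ A ω i i)
    (hlink : ∀ i j, G.Adj j i → ∀ᵐ ω ∂P,
      p ≤ (P⟦{ω' | γ ≤ A ω' i j} | MeasurableSpace.comap y inferInstance⟧) ω) :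
    ∫ ω, disagreement (mixed (A ω) (y ω)) ∂P ≤ (1 - γ * p / B) * ∫ ω, disagreement (y ω) ∂P := by
  classical
  set g : Fin m → Fin m → Ω → ℝ := fun i j ω => ‖y ω i - y ω j‖ ^ 2 with hg
  have hgm : ∀ i j, Measurable fun z : State m n => ‖z i - z j‖ ^ 2 := fun i j =>
    ((measurable_pi_apply i).sub (measurable_pi_apply j)).norm.pow_const 2
  have hgi : ∀ i j, Integrable (g i j) P := fun i j => by
    refine Integrable.of_bound ((hgm i j).comp hy).aestronglyMeasurable (r ^ 2) ?_
    filter_upwards [hr] with ω hω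
    rw [Real.norm_of_nonneg (by positivity)]
    simp only [hg]
    gcongr
    exact hω i j
  have hBm : ∀ i j, MeasurableSet {ω | γ ≤ A ω i j} := fun i j =>
    measurableSet_le measurable_const (hA i j)
  -- Squared distances are functions of `y`, so the bound conditional on `y` can be integrated
  -- against them.
  have hlow : ∀ i j, G.Adj j i →
      p * ∫ ω, g i j ω ∂P ≤ ∫ ω, {ω | γ ≤ A ω i j}.indicator (g i j) ω ∂P := fun i j hij =>
    mul_integral_le_of_le_condExp hy.comap_le
      ((hgm i j).comp (comap_measurable y)).stronglyMeasurable (hgi i j)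
      (fun ω => sq_nonneg _) (hBm i j) (hlink i j hij)
  have hQi := integrable_disagreement hy hr
  have hI1 : ∀ i j, Integrable
      (fun ω => if G.Adj j i then {ω | γ ≤ A ω i j}.indicator (g i j) ω else 0) P := fun i j => by
    split_ifs
    · exact (hgi i j).indicator (hBm i j)
    · exact integrable_zero _ _ _
  have hI2 : ∀ i j, Integrable (fun ω => if G.Adj j i then g i j ω else 0) P := fun i j => by
    split_ifs
    · exact hgi i j
    · exact integrable_zero _ _ _
  have hvm : Measurable fun ω => mixed (A ω) (y ω) :=
    measurable_pi_iff.2 fun i => Finset.measurable_fun_sum _ fun j _ =>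
      (hA i j).smul ((measurable_pi_apply j).comp hy)
  have hvi : Integrable (fun ω => disagreement (mixed (A ω) (y ω))) P := by
    refine integrable_disagreement hvm (r := r) ?_
    filter_upwards [hr, hstoch] with ω h1 h2
    exact norm_mixed_sub_mixed_le h2 _ h1
  have h1 : ∫ ω, disagreement (mixed (A ω) (y ω)) ∂P ≤ ∫ ω, (disagreement (y ω) -
      γ * ∑ i, ∑ j, if G.Adj j i then {ω | γ ≤ A ω i j}.indicator (g i j) ω else 0) ∂P := by
    refine integral_mono_ae hvi (hQi.sub ((integrable_finsetSum _ fun i _ =>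
      integrable_finsetSum _ fun j _ => hI1 i j).const_mul γ)) ?_
    filter_upwards [hstoch, ae_all_iff.2 hself] with ω h2 h3
    have := disagreement_mixed_le h2 hγ h3 G (y ω)
    simpa only [Set.indicator_apply, Set.mem_ofPred_eq, hg] using this
  rw [integral_sub hQi ((integrable_finsetSum _ fun i _ =>
      integrable_finsetSum _ fun j _ => hI1 i j).const_mul γ), integral_const_mul,
    integral_finsetSum _ fun i _ => integrable_finsetSum _ fun j _ => hI1 i j] at h1
  simp only [integral_finsetSum _ fun j _ => hI1 _ j] at h1
  have h2 : p * ∑ i, ∑ j, ∫ ω, (if G.Adj j i then g i j ω else 0) ∂P ≤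
      ∑ i, ∑ j, ∫ ω, (if G.Adj j i then {ω | γ ≤ A ω i j}.indicator (g i j) ω else 0) ∂P := by
    simp only [Finset.mul_sum]
    refine Finset.sum_le_sum fun i _ => Finset.sum_le_sum fun j _ => ?_
    split_ifs with hij
    · exact hlow i j hij
    · simp
  have h3 : ∫ ω, disagreement (y ω) ∂P ≤
      B * ∑ i, ∑ j, ∫ ω, (if G.Adj j i then g i j ω else 0) ∂P := by
    have : ∫ ω, disagreement (y ω) ∂P ≤
        ∫ ω, B * ∑ i, ∑ j, (if G.Adj j i then g i j ω else 0) ∂P :=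
      integral_mono hQi ((integrable_finsetSum _ fun i _ =>
        integrable_finsetSum _ fun j _ => hI2 i j).const_mul B) fun ω => hB (y ω)
    rw [integral_const_mul,
      integral_finsetSum _ fun i _ => integrable_finsetSum _ fun j _ => hI2 i j] at this
    simpa only [integral_finsetSum _ fun j _ => hI2 _ j] using this
  set E := ∑ i, ∑ j, ∫ ω, (if G.Adj j i then g i j ω else 0) ∂P
  have h4 : γ * p / B * ∫ ω, disagreement (y ω) ∂P ≤ γ * (p * E) := by
    calc _ ≤ γ * p / B * (B * E) := by gcongr
      _ = _ := by field_simp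
  have h5 := mul_le_mul_of_nonneg_left h2 hγ.le
  linarith

/-! ### Measurable choice of the limit -/

theorem isClosed_optimalSet {f : Fin m → Vec n → ℝ} (hf : ∀ i, ConvexOn ℝ Set.univ (f i))
    {X : Set (Vec n)} (hX : IsClosed X) : IsClosed (optimalSet f X) := by
  have hF : Continuous fun y => ∑ i, f i y :=
    continuous_finsetSum _ fun i _ => (hf i).locallyLipschitz.continuous
  have : optimalSet f X = X ∩ ⋂ y ∈ X, {x | ∑ i, f i x ≤ ∑ i, f i y} := by
    ext x; simp [optimalSet]
  rw [this]
  exact hX.inter (isClosed_biInter fun y _ => isClosed_le hF continuous_const)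

/-- An almost sure limit in a closed set can be chosen measurable and in the set everywhere. -/
theorem exists_measurable_limit {Ω ι E : Type*} [MeasurableSpace Ω] {P : Measure Ω}
    [TopologicalSpace E] [TopologicalSpace.PseudoMetrizableSpace E] [MeasurableSpace E]
    [BorelSpace E] {x : ℕ → Ω → ι → E} (hx : ∀ k i, Measurable fun ω => x k ω i)
    {Z : Set E} (hZ : IsClosed Z) (hne : Z.Nonempty)
    (h : ∀ᵐ ω ∂P, ∃ z ∈ Z, ∀ i, Tendsto (fun k => x k ω i) atTop (𝓝 z)) :
    ∃ w : Ω → E, Measurable w ∧ (∀ ω, w ω ∈ Z) ∧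
      ∀ᵐ ω ∂P, ∀ i, Tendsto (fun k => x k ω i) atTop (𝓝 (w ω)) := by
  classical
  obtain ⟨z₀, hz₀⟩ := hne
  rcases isEmpty_or_nonempty ι with hι | ⟨⟨i₀⟩⟩
  · exact ⟨fun _ => z₀, measurable_const, fun _ => hz₀, Eventually.of_forall fun _ i => hι.elim i⟩
  have h' : ∀ ω, ∃ z, (∃ z ∈ Z, ∀ i, Tendsto (fun k => x k ω i) atTop (𝓝 z)) →
      z ∈ Z ∧ ∀ i, Tendsto (fun k => x k ω i) atTop (𝓝 z) := fun ω => by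
    by_cases hω : ∃ z ∈ Z, ∀ i, Tendsto (fun k => x k ω i) atTop (𝓝 z)
    · obtain ⟨z, hz⟩ := hω
      exact ⟨z, fun _ => hz⟩
    · exact ⟨z₀, fun hh => absurd hh hω⟩
  choose w hw using h'
  have hwm : AEMeasurable w P := aemeasurable_of_tendsto_metrizable_ae' (f := fun k ω => x k ω i₀)
    (fun k => (hx k i₀).aemeasurable) (h.mono fun ω hω => (hw ω hω).2 i₀)
  -- The measurable version of `w` may leave `Z` on a null set; there it is reset to `z₀`.
  refine ⟨fun ω => if hwm.mk w ω ∈ Z then hwm.mk w ω else z₀,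
    Measurable.ite (hwm.measurable_mk hZ.measurableSet) hwm.measurable_mk measurable_const,
    fun ω => ?_, ?_⟩
  · dsimp only
    split_ifs with hω
    exacts [hω, hz₀]
  · filter_upwards [h, hwm.ae_eq_mk] with ω h1 h2
    rw [← h2, if_pos (hw ω h1).1]
    exact (hw ω h1).2

end MultiAgent

/-! ### The convergence theorem -/

open MultiAgent

theorem mainTheorem1 {m n : ℕ} {Ω S : Type*} [MeasurableSpace Ω] [MeasurableSpace S]
    (P : Measure Ω) [IsProbabilityMeasure P]
    -- local objectives, common constraint set, existence of an optimal solution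
    (f : Fin m → MultiAgent.Vec n → ℝ) (hf : ∀ i, ConvexOn ℝ Set.univ (f i))
    (X : Set (MultiAgent.Vec n)) (hXclosed : IsClosed X) (hXconvex : Convex ℝ X)
    (hopt : (MultiAgent.optimalSet f X).Nonempty)
    (hL : MultiAgent.BoundedSubgradients f)
    -- independent noise and state-dependent communication matrices
    (ν : ℕ → Ω → S) (hν : ∀ k, Measurable (ν k)) (hindep : iIndepFun ν P)
    (ψ : MultiAgent.State m n → S → Matrix (Fin m) (Fin m) ℝ)
    (hψ : ∀ i j, Measurable (fun z : MultiAgent.State m n × S => ψ z.1 z.2 i j))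
    -- stepsizes
    (α : ℕ → ℝ) (hαpos : ∀ k, 0 < α k)
    (hαsum : Tendsto (fun N => ∑ k ∈ Finset.range N, α k) atTop atTop)
    (hαlim : MultiAgent.LimitingStepsizes α)
    -- the iterates
    (x0 : MultiAgent.State m n) (d x : ℕ → Ω → MultiAgent.State m n)
    (hrun : MultiAgent.IsSubgradientRun f (fun _ => X) α ψ ν x0 d x)
    -- connectivity of the backbone graph and communication probabilities along its edges
    (G : Digraph (Fin m)) (hG : MultiAgent.StronglyConnected G)
    (γ δ K C : ℝ) (hγ : 0 < γ) (hδ : 0 < δ) (hδ1 : δ ≤ 1) (hK : 0 < K) (hC : 0 < C)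
    (hlink : ∀ j i, G.Adj j i → ∀ k, ∀ᵐ ω ∂P,
      MultiAgent.linkBound δ K C ‖x k ω i - x k ω j‖ ≤
        (P⟦{ω' | γ ≤ MultiAgent.commMatrix ψ ν x k ω' i j} |
          MeasurableSpace.comap (x k) inferInstance⟧) ω)
    -- doubly stochastic weights and self-confidence
    (hstoch : ∀ k, ∀ᵐ ω ∂P, MultiAgent.commMatrix ψ ν x k ω ∈ doublyStochastic ℝ (Fin m))
    (hself : ∀ k i, ∀ᵐ ω ∂P, γ ≤ MultiAgent.commMatrix ψ ν x k ω i i) :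
    ∃ xstar : Ω → MultiAgent.Vec n, Measurable xstar ∧
      (∀ ω, xstar ω ∈ MultiAgent.optimalSet f X) ∧
      ∀ᵐ ω ∂P, ∀ i, Tendsto (fun k => x k ω i) atTop (𝓝 (xstar ω)) := by
  have hne : X.Nonempty := hopt.mono fun _ h => h.1
  have hL' := hL
  obtain ⟨L, hL0, hL⟩ := hL
  have hα0 : ∀ k, 0 ≤ α k := fun k => (hαpos k).le
  have hxm := hrun.measurable hXclosed hXconvex hne hν hψ
  have hAm : ∀ k i j, Measurable fun ω => commMatrix ψ ν x k ω i j := fun k =>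
    IsSubgradientRun.measurable_commMatrix hν hψ (hxm k)
  have htraj := hrun.ae_trajectory hstoch
  -- a deterministic bound on the distances between agents
  set R : ℕ → ℝ := fun k =>
    (1 + √(disagreement x0)) + 2 * L * ∑ l ∈ Finset.range k, α l with hR
  have hR1 : ∀ k, 1 ≤ R k := fun k => by
    have h1 := Real.sqrt_nonneg (disagreement x0)
    have h2 := Finset.sum_nonneg fun l (_ : l ∈ Finset.range k) => hα0 l
    have : 0 ≤ 2 * L * ∑ l ∈ Finset.range k, α l := by positivity
    simp only [hR]
    linarith
  have hxR : ∀ᵐ ω ∂P, ∀ k i j, ‖x k ω i - x k ω j‖ ≤ R k := by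
    filter_upwards [htraj] with ω hω k i j
    refine hω.norm_sub_le hXclosed hXconvex hne hα0 hL (fun i j => ?_) k i j
    rw [hrun.init]
    exact (norm_sub_le_sqrt_disagreement x0 i j).trans (by linarith)
  obtain ⟨B, hB0, hB⟩ := exists_disagreement_le (n := n) hG
  set p : ℕ → ℝ := fun k => min δ (K / R k ^ C) with hp
  have hp0 : ∀ k, 0 < p k := fun k => by
    have : 0 < R k := one_pos.trans_le (hR1 k)
    exact lt_min hδ (by positivity)
  -- Enlarging `B` to `B + γ` keeps the graph inequality and, as `p k ≤ 1`, forces `q k ≤ 1`.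
  set q : ℕ → ℝ := fun k => γ * p k / (B + γ) with hq
  have hq0 : ∀ k, 0 < q k := fun k => by
    have := hp0 k
    positivity
  have hq1 : ∀ k, q k ≤ 1 := fun k => by
    have h1 : p k ≤ 1 := (min_le_left _ _).trans hδ1
    rw [hq, div_le_one (by positivity)]
    nlinarith
  -- summability of the stepsizes
  obtain ⟨c, hc0, hc⟩ := hαlim.exists_le_div hαpos
  have hαR : Summable fun k => α k ^ 2 * R k ^ C :=
    summable_sq_mul_rpow hα0 hc (by positivity) (by positivity) hC
  have hαsq : Summable fun k => α k ^ 2 :=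
    Summable.of_nonneg_of_le (fun k => sq_nonneg _)
      (fun k => le_mul_of_one_le_right (sq_nonneg _) (Real.one_le_rpow (hR1 k) hC.le)) hαR
  have hαq : Summable fun k => α k ^ 2 / q k := by
    refine Summable.of_nonneg_of_le (fun k => by have := hq0 k; positivity) (fun k => ?_)
      (hαR.mul_left ((B + γ) / γ * (δ⁻¹ + K⁻¹)))
    have h1 := inv_min_div_rpow_le hδ hK hC.le (hR1 k)
    calc α k ^ 2 / q k = (B + γ) / γ * (α k ^ 2 * (p k)⁻¹) := by
          have := (hp0 k).ne'
          simp only [hq]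
          field_simp
      _ ≤ (B + γ) / γ * (α k ^ 2 * ((δ⁻¹ + K⁻¹) * R k ^ C)) := by gcongr
      _ = _ := by ring
  -- the expected disagreement
  set u : ℕ → ℝ := fun k => ∫ ω, disagreement (x k ω) ∂P with hu
  have hui : ∀ k, Integrable (fun ω => disagreement (x k ω)) P := fun k =>
    integrable_disagreement (hxm k) (hxR.mono fun ω hω => hω k)
  have hu0 : ∀ k, 0 ≤ u k := fun k => integral_nonneg fun ω => disagreement_nonneg _
  have hmix : ∀ k, ∫ ω, disagreement (mixed (commMatrix ψ ν x k ω) (x k ω)) ∂P ≤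
      (1 - q k) * u k := fun k =>
    integral_disagreement_mixed_le (by positivity) (fun z => (hB z).trans (by
        refine mul_le_mul_of_nonneg_right (by linarith) (Finset.sum_nonneg fun i _ =>
          Finset.sum_nonneg fun j _ => ?_)
        split_ifs <;> positivity)) hγ (hp0 k).le (hxm k) (hAm k)
      (hxR.mono fun ω hω => hω k) (hstoch k) (hself k) fun i j hij => by
        filter_upwards [hlink j i hij k, hxR] with ω h1 h2
        exact (min_div_rpow_le_linkBound hK.le hC.le (norm_nonneg _) (h2 k i j)).trans h1
  have hmixi : ∀ k,
      Integrable (fun ω => disagreement (mixed (commMatrix ψ ν x k ω) (x k ω))) P := fun k => by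
    refine integrable_disagreement (IsSubgradientRun.measurable_mixed hν hψ (hxm k))
      (r := R k) ?_
    filter_upwards [hxR, hstoch k] with ω h1 h2
    exact norm_mixed_sub_mixed_le h2 _ (h1 k)
  set D : ℝ := 4 * m ^ 2 * L ^ 2 with hD
  -- Young's parameter is `q / 2`: `(1 + q/2) (1 - q) ≤ 1 - q/2`, and `1 + 2/q ≤ 3/q` because `q ≤
  -- 1`.
  have hstep : ∀ k, u (k + 1) ≤ u k + 3 * D * (α k ^ 2 / q k) - 1 / 2 * (q k * u k) := fun k => by
    have hqk := hq0 k
    have hη : 0 < q k / 2 := by positivity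
    have h1 : u (k + 1) ≤ ∫ ω, ((1 + q k / 2) *
        disagreement (mixed (commMatrix ψ ν x k ω) (x k ω)) +
        (1 + 1 / (q k / 2)) * (4 * m ^ 2 * (L * α k) ^ 2)) ∂P := by
      refine integral_mono_ae (hui (k + 1)) (((hmixi k).const_mul _).add (integrable_const _)) ?_
      filter_upwards [htraj] with ω hω
      exact hω.disagreement_succ_le hXclosed hXconvex hne hα0 hL hη k
    rw [integral_add ((hmixi k).const_mul _) (integrable_const _), integral_const_mul,
      integral_const, probReal_univ, one_smul] at h1
    have h2 : (1 + q k / 2) * ∫ ω, disagreement (mixed (commMatrix ψ ν x k ω) (x k ω)) ∂P ≤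
        (1 + q k / 2) * ((1 - q k) * u k) := by gcongr; exact hmix k
    have h3 : (1 + q k / 2) * ((1 - q k) * u k) ≤ u k - 1 / 2 * (q k * u k) := by
      have := mul_nonneg (sq_nonneg (q k)) (hu0 k)
      linarith
    have h4 : (1 + 1 / (q k / 2)) * (4 * m ^ 2 * (L * α k) ^ 2) ≤ 3 * D * (α k ^ 2 / q k) := by
      have h5 : 1 + 1 / (q k / 2) ≤ 3 / q k := by
        rw [le_div_iff₀ hqk]
        have : (1 + 1 / (q k / 2)) * q k = q k + 2 := by field_simp
        linarith [hq1 k]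
      calc _ ≤ 3 / q k * (4 * m ^ 2 * (L * α k) ^ 2) := by gcongr
        _ = _ := by rw [hD]; ring
    linarith
  have hqu : Summable fun k => q k * u k := by
    have h1 : ∀ k, 0 ≤ 1 / 2 * (q k * u k) := fun k =>
      mul_nonneg (by norm_num) (mul_nonneg (hq0 k).le (hu0 k))
    have := summable_of_le_add_sub hu0
      (fun k => by have := hq0 k; positivity) h1 (hαq.mul_left (3 * D)) hstep
    exact (this.mul_left 2).congr fun k => by ring
  have hqQ : ∀ᵐ ω ∂P, Summable fun k => q k * disagreement (x k ω) :=
    ae_summable_of_summable_integral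
      (fun k ω => mul_nonneg (hq0 k).le (disagreement_nonneg _))
      (fun k => (hui k).const_mul _) (by simpa only [integral_const_mul] using hqu)
  have hconv : ∀ᵐ ω ∂P, ∃ z ∈ optimalSet f X, ∀ i,
      Tendsto (fun k => x k ω i) atTop (𝓝 z) := by
    filter_upwards [htraj, hqQ] with ω h1 h2
    refine h1.exists_tendsto hXclosed hXconvex hf hopt hL' hα0 hαsum hαsq ?_
    refine Summable.of_nonneg_of_le (fun k => mul_nonneg (hα0 k) (Real.sqrt_nonneg _))
      (fun k => ?_) (hαq.add h2)
    have hqk := hq0 k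
    have h3 := Real.sq_sqrt (disagreement_nonneg (x k ω))
    set s := √(disagreement (x k ω))
    -- Completing the square shows `α s ≤ α ^ 2 / q + q s ^ 2`, so both summable series control `α *
    -- √Q`.
    have h4 : α k ^ 2 / q k + q k * disagreement (x k ω) - α k * s =
        ((α k - q k * s) ^ 2 + α k * (q k * s)) / q k := by
      rw [← h3]; field_simp; ring
    have h5 : 0 ≤ ((α k - q k * s) ^ 2 + α k * (q k * s)) / q k := by
      have := hα0 k
      have : 0 ≤ s := Real.sqrt_nonneg _
      positivity
    linarith
  exact exists_measurable_limit (fun k i => (measurable_pi_apply i).comp (hxm k))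
    (isClosed_optimalSet hf hXclosed) hopt hconv
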